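/- **Games.** An XOR game $G=(f,\pi)$ consists of finite sets $S,T$, a function $f:S\times T\to\{0,1\}$ and a probability distribution $\pi$ on $S\times T$; on questions $(s,t)$ drawn from $\pi$, Alice receives $s$, Bob receives $t$, they answer with bits $a,b$ and win iff $a\oplus b=f(s,t)$. For XOR games $G_i=(f_i,\pi_i)$ on $S_i\times T_i$ ($1\le i\le n$), the conjunction $\wedge_{i=1}^nG_i$ is the game with question sets $S=\prod_iS_i$, $T=\prod_iT_i$, distribution $\pi(s,t)=\prod_i\pi_i(s_i,t_i)$, answer sets $A=B=\{0,1\}^n$, and winning predicate $V(a,b|s,t)=1$ if $a_i\oplus b_i=f_i(s_i,t_i)$ for all $i$, and $V(a,b|s,t)=0$ otherwise. **Values.** Let $G$ be a game with finite question sets $S,T$, finite answer sets $A,B$, distribution $\pi$ and predicate $V$. * The quantum value $\omega_q(G)$ is the maximum of $$\sum_{s,t}\pi(s,t)\sum_{a,b}V(a,b|s,t)\,\langle\psi|M_s^a\otimes N_t^b|\psi\rangle$$ over all finite-dimensional complex Hilbert spaces $\mathcal A,\mathcal B$, unit vectors $|\psi\rangle\in\mathcal A\otimes\mathcal B$, and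 POVMs $\{M_s^a\}_{a\in A}$ on $\mathcal A$ ($s\in S$) and $\{N_t^b\}_{b\in B}$ on $\mathcal B$ ($t\in T$). * Let $C_{(s,a),(t,b)}=\pi(s,t)V(a,b|s,t)$ and $\hat C=\frac12\begin{pmatrix}0&C\\C^T&0\end{pmatrix}$. The first Feige–Lovász relaxation $\sigma(G)$ is the maximum of $\operatorname{Tr}(\hat CP)$ over real symmetric positive semidefinite matrices $P$, indexed by the disjoint union of $S\times A$ and $T\times B$, all of whose entries are nonnegative and such that, for all $s,t$ in the disjoint union $S\sqcup T$, $\sum_{a,b}P_{(s,a),(t,b)}=1$, where $a$ and $b$ run over the answers to the questions $s$ and $t$, respectively. * The second Feige–Lovász relaxation $\bar\sigma(G)$ is the maximum of $\operatorname{Tr}(\hat CP)$ over real symmetric positive semidefinite matrices $P$ with the same index set such that $\sum_{a,b}|P_{(s,a),(t,b)}|\le1$ whenever $s,t\in S$ or $s,t\in T$, and $P_{(s,a),(t,b)}\ge0$ for all $s\in S$, $t\in T$, $a\in A$, $b\in B$. **Proposition.** For any XOR games $G_1,\dots,G_n$, the three maxima for the game $\wedge_{i=1}^nG_i$ are attained,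 and $$\omega_q(\wedge_{i=1}^nG_i)=\sigma(\wedge_{i=1}^nG_i)=\bar\sigma(\wedge_{i=1}^nG_i).$$ -/

import Mathlib

open scoped Kronecker Matrix ComplexOrder

/-- A two-prover one-round game with finite question sets `S`, `T` and finite answer sets `A`, `B`:
a probability distribution `π` on `S × T` and a `{0,1}`-valued predicate `V(a,b|s,t)`. -/
structure TwoProverGame (S T A B : Type*) [Fintype S] [Fintype T] where
  π : S → T → ℝ
  π_nonneg : ∀ s t, 0 ≤ π s t
  π_sum : ∑ s, ∑ t, π s t = 1
  V : S → T → A → B → Bool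

/-- An XOR game `(f, π)`: the answers are bits, and the provers win iff `a ⊕ b = f(s,t)`. -/
structure XORGame (S T : Type*) [Fintype S] [Fintype T] where
  f : S → T → Bool
  π : S → T → ℝ
  π_nonneg : ∀ s t, 0 ≤ π s t
  π_sum : ∑ s, ∑ t, π s t = 1

/-- The conjunction of finitely many XOR games: all of them are played simultaneously, with
independent question pairs, and the provers have to win every one of them. -/
def XORGame.conjunction {n : ℕ} {S T : Fin n → Type*} [∀ i, Fintype (S i)] [∀ i, Fintype (T i)]
    (G : ∀ i, XORGame (S i) (T i)) :
    TwoProverGame (∀ i, S i) (∀ i, T i) (Fin n → Bool) (Fin n → Bool) where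
  π s t := ∏ i, (G i).π (s i) (t i)
  π_nonneg s t := Finset.prod_nonneg fun i _ => (G i).π_nonneg _ _
  π_sum := by
    simp only [← Fintype.prod_sum]
    rw [← Fintype.prod_sum (fun i x => ∑ j, (G i).π x j)]
    exact Finset.prod_eq_one fun i _ => (G i).π_sum
  V s t a b := decide (∀ i, xor (a i) (b i) = (G i).f (s i) (t i))

/-- A quantum strategy: a shared pure state `ψ ∈ ℂ^dA ⊗ ℂ^dB`, and for each question a POVM
on Alice's, respectively Bob's, part of the state, indexed by the answers. -/
structure QuantumStrategy (S T A B : Type*) [Fintype A] [Fintype B] where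
  dA : ℕ
  dB : ℕ
  ψ : Fin dA × Fin dB → ℂ
  ψ_unit : star ψ ⬝ᵥ ψ = 1
  M : S → A → Matrix (Fin dA) (Fin dA) ℂ
  M_pos : ∀ s a, (M s a).PosSemidef
  M_sum : ∀ s, ∑ a, M s a = 1
  N : T → B → Matrix (Fin dB) (Fin dB) ℂ
  N_pos : ∀ t b, (N t b).PosSemidef
  N_sum : ∀ t, ∑ b, N t b = 1

/-- The probability `⟨ψ| M_s^a ⊗ N_t^b |ψ⟩` of the answers `a`, `b` to the questions `s`, `t`. -/
noncomputable def QuantumStrategy.prob {S T A B : Type*} [Fintype A] [Fintype B]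
    (Q : QuantumStrategy S T A B) (s : S) (t : T) (a : A) (b : B) : ℝ :=
  (star Q.ψ ⬝ᵥ ((Q.M s a ⊗ₖ Q.N t b) *ᵥ Q.ψ)).re

namespace TwoProverGame

variable {S T A B : Type*} [Fintype S] [Fintype T] [Fintype A] [Fintype B]

/-- The success probability of a quantum strategy. -/
noncomputable def successProb (G : TwoProverGame S T A B) (Q : QuantumStrategy S T A B) : ℝ :=
  ∑ s, ∑ t, G.π s t * ∑ a, ∑ b, if G.V s t a b then Q.prob s t a b else 0

/-- The quantum value `ω_q(G)`. -/
noncomputable def quantumValue (G : TwoProverGame S T A B) : ℝ :=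
  sSup (Set.range G.successProb)

/-- The matrix `C` with entries `C_{(s,a),(t,b)} = π(s,t) V(a,b|s,t)`. -/
noncomputable def costMatrix (G : TwoProverGame S T A B) : Matrix (S × A) (T × B) ℝ :=
  Matrix.of fun i j => G.π i.1 j.1 * if G.V i.1 j.1 i.2 j.2 then 1 else 0

/-- The symmetric matrix `Ĉ = ½ [[0, C], [Cᵀ, 0]]`. -/
noncomputable def symCostMatrix (G : TwoProverGame S T A B) :
    Matrix ((S × A) ⊕ (T × B)) ((S × A) ⊕ (T × B)) ℝ :=
  (1 / 2 : ℝ) • Matrix.fromBlocks 0 G.costMatrix G.costMatrixᵀ 0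

/-- The common objective function `Tr(Ĉ P)` of the two Feige–Lovász relaxations. -/
noncomputable def objective (G : TwoProverGame S T A B)
    (P : Matrix ((S × A) ⊕ (T × B)) ((S × A) ⊕ (T × B)) ℝ) : ℝ :=
  (G.symCostMatrix * P).trace

end TwoProverGame

/-- Feasibility for the first Feige–Lovász relaxation. The block sums equal `1` for all pairs of
questions in the disjoint union of `S` and `T`, which is spelled out in four cases. -/
structure FeasibleSigma {S T A B : Type*} [Fintype A] [Fintype B]
    (P : Matrix ((S × A) ⊕ (T × B)) ((S × A) ⊕ (T × B)) ℝ) : Prop where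
  posSemidef : P.PosSemidef
  nonneg : ∀ i j, 0 ≤ P i j
  sum_SS : ∀ s s' : S, ∑ a, ∑ a', P (.inl (s, a)) (.inl (s', a')) = 1
  sum_ST : ∀ (s : S) (t : T), ∑ a, ∑ b, P (.inl (s, a)) (.inr (t, b)) = 1
  sum_TS : ∀ (t : T) (s : S), ∑ b, ∑ a, P (.inr (t, b)) (.inl (s, a)) = 1
  sum_TT : ∀ t t' : T, ∑ b, ∑ b', P (.inr (t, b)) (.inr (t', b')) = 1

/-- Feasibility for the second Feige–Lovász relaxation. -/
structure FeasibleSigmaBar {S T A B : Type*} [Fintype A] [Fintype B]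
    (P : Matrix ((S × A) ⊕ (T × B)) ((S × A) ⊕ (T × B)) ℝ) : Prop where
  posSemidef : P.PosSemidef
  nonneg_ST : ∀ (s : S) (t : T) (a : A) (b : B), 0 ≤ P (.inl (s, a)) (.inr (t, b))
  sum_SS : ∀ s s' : S, ∑ a, ∑ a', |P (.inl (s, a)) (.inl (s', a'))| ≤ 1
  sum_TT : ∀ t t' : T, ∑ b, ∑ b', |P (.inr (t, b)) (.inr (t', b'))| ≤ 1

namespace TwoProverGame

variable {S T A B : Type*} [Fintype S] [Fintype T] [Fintype A] [Fintype B]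

/-- The optimum `σ(G)` of the first Feige–Lovász relaxation. -/
noncomputable def sigma (G : TwoProverGame S T A B) : ℝ :=
  sSup (G.objective '' {P | FeasibleSigma P})

/-- The optimum `σ̄(G)` of the second Feige–Lovász relaxation. -/
noncomputable def sigmaBar (G : TwoProverGame S T A B) : ℝ :=
  sSup (G.objective '' {P | FeasibleSigmaBar P})

end TwoProverGame

/-! For one XOR game put `A s t = π(s,t) (-1)^f(s,t)` and let γ be the maximum of `∑ A s t * Γ s t`
over correlation matrices Γ. Duality gives a positive semidefinite matrix with off-diagonal block
`A` and diagonal blocks `diag p`, `diag q`, where `p` and `q` both sum to γ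
(`exists_bipartite_correlation_dual`). All three values of the conjunction equal `∏ (1 + γ i) / 2`.

Upper bound. The winning indicator is half of one plus a sign, so `C` is a product over the games of
terms `(π ± A) / 2`. It is therefore the off-diagonal block of an entrywise product `D` of positive
semidefinite matrices, one per game, built from the question distribution and the dual solution. The
diagonal blocks of `D` live on equal questions and are nonnegative combinations of characters of the
answer bits. Pairing `D` with `P`, off-diagonal signs reversed, bounds the objective as soon as each
character sum over a diagonal question block of `P` is at most 1 (`objective_conjunction_le`). This
covers σ̄-feasible `P`, and also Gram matrices of quantum strategies, since `±1` combinations of a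
POVM are contractions (`sum_sign_povm_le`).

Lower bound. Optimal Γ for the single games multiply to a σ-feasible matrix
(`feasibleSigma_correlationSolution`), and Tsirelson's observables, measured in parallel on
maximally entangled states, produce the same answer probabilities (`exists_quantumStrategy`). -/

namespace Matrix

/-! ### Positive semidefinite matrices and duality over correlation matrices. -/

section PosSemidef

variable {ι : Type*}

/-- A real symmetric matrix is positive semidefinite iff its quadratic form is nonnegative. -/
lemma posSemidef_real_iff [Fintype ι] {M : Matrix ι ι ℝ} :
    M.PosSemidef ↔ (∀ i j, M i j = M j i) ∧ ∀ x : ι → ℝ, 0 ≤ ∑ i, ∑ j, x i * M i j * x j := by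
  rw [posSemidef_iff_dotProduct_mulVec]
  refine and_congr ⟨fun h i j => by simpa using (h.apply i j).symm,
    fun h => by ext i j; simpa using h j i⟩ (forall_congr' fun x => ?_)
  simp [dotProduct, mulVec, Finset.mul_sum, mul_assoc]

lemma PosSemidef.real_symm [Fintype ι] {M : Matrix ι ι ℝ} (hM : M.PosSemidef) (i j : ι) :
    M i j = M j i := (posSemidef_real_iff.1 hM).1 i j

/-- The entrywise pairing of two positive semidefinite matrices is nonnegative. -/
lemma PosSemidef.sum_mul_nonneg [Fintype ι] {M P : Matrix ι ι ℝ} (hM : M.PosSemidef)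
    (hP : P.PosSemidef) : 0 ≤ ∑ i, ∑ j, M i j * P i j := by
  simpa using (posSemidef_real_iff.1 (hM.hadamard hP)).2 fun _ => 1

lemma posSemidef_one_entries (𝕜 : Type*) [RCLike 𝕜] [Finite ι] :
    (of fun _ _ => 1 : Matrix ι ι 𝕜).PosSemidef := by
  convert posSemidef_vecMulVec_self_star (fun _ : ι => (1 : 𝕜)) using 1
  ext; simp [vecMulVec]

/-- Schur product theorem for finitely many factors. -/
lemma PosSemidef.prod_entries {𝕜 κ : Type*} [RCLike 𝕜] [Finite ι] (s : Finset κ)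
    {M : κ → Matrix ι ι 𝕜} (hM : ∀ k, (M k).PosSemidef) :
    (of fun x y => ∏ k ∈ s, M k x y).PosSemidef := by
  classical
  induction s using Finset.induction_on with
  | empty => simpa using posSemidef_one_entries 𝕜
  | insert k s hk ih =>
    convert (hM k).hadamard ih using 1
    ext x y
    simp [Finset.prod_insert hk]

lemma PosSemidef.scale [Finite ι] {M : Matrix ι ι ℝ} (hM : M.PosSemidef) (c : ι → ℝ) :
    (of fun i j => c i * c j * M i j).PosSemidef := by
  have h := (posSemidef_vecMulVec_self_star c).hadamard hM
  have he : vecMulVec c (star c) ⊙ M = of fun i j => c i * c j * M i j := by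
    ext; simp [vecMulVec]
  rwa [he] at h

/-- Test the 2 × 2 principal submatrix on `(1, 1)` and `(1, -1)`. -/
lemma PosSemidef.abs_le_one {M : Matrix ι ι ℝ} (hM : M.PosSemidef) (h1 : ∀ i, M i i = 1)
    (i j : ι) : |M i j| ≤ 1 := by
  have h := posSemidef_real_iff.1 (hM.submatrix ![i, j])
  have hs := h.1 0 1
  have hp := h.2 ![1, 1]
  have hm := h.2 ![1, -1]
  simp [Fin.sum_univ_two, h1] at hs hp hm
  rw [abs_le]
  constructor <;> linarith

lemma isClosed_posSemidef [Fintype ι] : IsClosed {M : Matrix ι ι ℝ | M.PosSemidef} := by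
  simp only [posSemidef_real_iff, Set.ofPred_and, Set.ofPred_forall]
  refine IsClosed.inter ?_ ?_
  · refine isClosed_iInter fun i => isClosed_iInter fun j => isClosed_eq ?_ ?_ <;> fun_prop
  · exact isClosed_iInter fun x => isClosed_le (by fun_prop) (by fun_prop)

/-- The correlation matrices form a compact set. -/
lemma isCompact_correlation [Fintype ι] :
    IsCompact {M : Matrix ι ι ℝ | M.PosSemidef ∧ ∀ i, M i i = 1} := by
  have hc : IsCompact (Set.univ.pi fun _ => Set.univ.pi fun _ => Set.Icc (-1) 1 :
      Set (ι → ι → ℝ)) :=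
    isCompact_univ_pi fun _ => isCompact_univ_pi fun _ => isCompact_Icc
  refine IsCompact.of_isClosed_subset hc ?_ ?_
  · rw [Set.ofPred_and, Set.ofPred_forall]
    exact isClosed_posSemidef.inter
      (isClosed_iInter fun i => isClosed_eq (by fun_prop) continuous_const)
  · rintro M ⟨hM, h1⟩ i - j -
    exact abs_le.1 (hM.abs_le_one h1 i j)

lemma PosSemidef.vec_outer [Finite ι] (x : ι → ℝ) :
    (of fun i j => x i * x j : Matrix ι ι ℝ).PosSemidef := by
  convert posSemidef_vecMulVec_self_star x using 1
  ext; simp [vecMulVec]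

/-- A one-sided comparison suffices, because the perturbation of the optimum used below stays
positive semidefinite only for `d ≥ 0`. -/
lemma nonpos_of_hasDerivAt_of_le {g : ℝ → ℝ} {g' : ℝ} (hg : HasDerivAt g g' 0)
    (h : ∀ d, 0 < d → g d ≤ g 0) : g' ≤ 0 := by
  have ht := (hasDerivAt_iff_tendsto_slope.1 hg).mono_left
    (nhdsWithin_mono 0 (s := Set.Ioi (0 : ℝ)) (t := {0}ᶜ) fun x hx => (Set.mem_Ioi.1 hx).ne')
  refine le_of_tendsto ht ?_
  filter_upwards [self_mem_nhdsWithin] with d hd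
  rw [slope_def_field]
  exact div_nonpos_of_nonpos_of_nonneg (sub_nonpos.2 (h d (Set.mem_Ioi.1 hd)))
    (by simpa using le_of_lt (Set.mem_Ioi.1 hd))

/-- Strong duality for the maximization of a linear functional over correlation matrices. -/
theorem exists_correlation_dual [Fintype ι] [DecidableEq ι] {B : Matrix ι ι ℝ}
    (hB : ∀ i j, B i j = B j i) :
    ∃ Γ : Matrix ι ι ℝ, Γ.PosSemidef ∧ (∀ i, Γ i i = 1) ∧
      (diagonal (fun i => ∑ j, B i j * Γ i j) - B).PosSemidef := by
  -- Γ is a primal maximizer; the dual certificate is its first-order optimality condition, so no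
  -- minimax theorem is needed.
  obtain ⟨Γ, ⟨hΓ, h1⟩, hmax⟩ := isCompact_correlation.exists_isMaxOn
    (s := {M : Matrix ι ι ℝ | M.PosSemidef ∧ ∀ i, M i i = 1})
    ⟨1, PosSemidef.one, by simp⟩
    (f := fun M => ∑ i, ∑ j, B i j * M i j) (by fun_prop)
  refine ⟨Γ, hΓ, h1, posSemidef_real_iff.2 ⟨fun i j => ?_, fun x => ?_⟩⟩
  · rcases eq_or_ne i j with rfl | hij
    · rfl
    · simp [diagonal_apply_ne _ hij, diagonal_apply_ne _ hij.symm, hB i j]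
  -- Move from Γ towards `Γ + d x xᵀ`; the factors `r i d` rescale the diagonal back to 1.
  set r : ι → ℝ → ℝ := fun i d => (√(1 + d * x i ^ 2))⁻¹
  set g : ℝ → ℝ := fun d => ∑ i, ∑ j, B i j * (r i d * r j d * (Γ i j + d * (x i * x j)))
  have hle : ∀ d, 0 < d → g d ≤ g 0 := by
    intro d hd
    have hfeas : (of fun i j => r i d * r j d * (Γ + d • of fun i j => x i * x j) i j :
        Matrix ι ι ℝ) ∈ {M : Matrix ι ι ℝ | M.PosSemidef ∧ ∀ i, M i i = 1} := by
      refine ⟨(hΓ.add ((PosSemidef.vec_outer x).smul hd.le)).scale _, fun i => ?_⟩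
      have hpos : 0 < 1 + d * x i ^ 2 := by positivity
      have hs := Real.mul_self_sqrt hpos.le
      simp only [of_apply, add_apply, smul_apply, h1, smul_eq_mul, r]
      rw [← mul_inv, hs, ← pow_two, inv_mul_cancel₀ hpos.ne']
    have := hmax hfeas
    simpa [g, r] using this
  have hr : ∀ i, HasDerivAt (r i) (-(x i ^ 2 / 2)) 0 := by
    intro i
    have h0 : HasDerivAt (fun d : ℝ => 1 + d * x i ^ 2) (x i ^ 2) 0 := by
      simpa using ((hasDerivAt_id (0 : ℝ)).mul_const (x i ^ 2)).const_add 1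
    have := (h0.sqrt (by simp)).fun_inv (by simp)
    simpa [r] using this
  have hg : HasDerivAt g (∑ i, ∑ j, B i j *
      ((-(x i ^ 2 / 2) + -(x j ^ 2 / 2)) * Γ i j + x i * x j)) 0 := by
    refine HasDerivAt.fun_sum fun i _ => HasDerivAt.fun_sum fun j _ => HasDerivAt.const_mul _ ?_
    have hl : HasDerivAt (fun d : ℝ => Γ i j + d * (x i * x j)) (x i * x j) 0 := by
      simpa using ((hasDerivAt_id (0 : ℝ)).mul_const (x i * x j)).const_add (Γ i j)
    convert ((hr i).fun_mul (hr j)).fun_mul hl using 1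
    simp [r]
  have hfin := nonpos_of_hasDerivAt_of_le hg hle
  -- By symmetry of `B` and Γ both rescaling factors contribute equally, so the derivative is minus
  -- the quadratic form to be bounded.
  have hsw : ∑ i, ∑ j, B i j * (x j ^ 2 / 2 * Γ i j) =
      ∑ i, ∑ j, B i j * (x i ^ 2 / 2 * Γ i j) := by
    rw [Finset.sum_comm]
    exact Finset.sum_congr rfl fun i _ => Finset.sum_congr rfl fun j _ => by
      rw [hB i j, hΓ.real_symm i j]
  have hL : ∑ i, ∑ j, B i j * ((-(x i ^ 2 / 2) + -(x j ^ 2 / 2)) * Γ i j + x i * x j) =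
      -(∑ i, ∑ j, B i j * (x i ^ 2 / 2 * Γ i j)) - ∑ i, ∑ j, B i j * (x j ^ 2 / 2 * Γ i j)
      + ∑ i, ∑ j, B i j * (x i * x j) := by
    simp only [← Finset.sum_add_distrib, ← Finset.sum_neg_distrib, ← Finset.sum_sub_distrib]
    exact Finset.sum_congr rfl fun i _ => Finset.sum_congr rfl fun j _ => by ring
  have hR : ∑ i, ∑ j, x i * (diagonal (fun i => ∑ j, B i j * Γ i j) - B) i j * x j =
      2 * (∑ i, ∑ j, B i j * (x i ^ 2 / 2 * Γ i j)) - ∑ i, ∑ j, B i j * (x i * x j) := by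
    rw [Finset.mul_sum, ← Finset.sum_sub_distrib]
    refine Finset.sum_congr rfl fun i _ => ?_
    simp only [sub_apply, mul_sub, sub_mul, Finset.sum_sub_distrib]
    congr 1
    · simp only [diagonal_apply, mul_ite, ite_mul, mul_zero, zero_mul, Finset.sum_ite_eq,
        Finset.mem_univ, if_true, Finset.mul_sum, Finset.sum_mul]
      exact Finset.sum_congr rfl fun j _ => by ring
    · exact Finset.sum_congr rfl fun j _ => by ring
  rw [hR]
  rw [hL, hsw] at hfin
  linarith

/-- Strong duality for the maximization of `∑ A s t * Γ s t`, with `Γ s t` the inner products of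
two families of unit vectors. -/
theorem exists_bipartite_correlation_dual {S T : Type*} [Fintype S] [Fintype T] [DecidableEq S]
    [DecidableEq T] (A : Matrix S T ℝ) :
    ∃ (Γ : Matrix (S ⊕ T) (S ⊕ T) ℝ) (p : S → ℝ) (q : T → ℝ), Γ.PosSemidef ∧ (∀ i, Γ i i = 1) ∧
      (fromBlocks (diagonal p) A Aᵀ (diagonal q)).PosSemidef ∧
      ∑ s, p s = ∑ s, ∑ t, A s t * Γ (.inl s) (.inr t) ∧
      ∑ t, q t = ∑ s, ∑ t, A s t * Γ (.inl s) (.inr t) := by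
  obtain ⟨Γ, hΓ, h1, hD⟩ := exists_correlation_dual (B := fromBlocks 0 A Aᵀ 0) (by
    rintro (i | i) (j | j) <;> simp)
  refine ⟨Γ, fun s => ∑ t, A s t * Γ (.inl s) (.inr t),
    fun t => ∑ s, A s t * Γ (.inr t) (.inl s), hΓ, h1, ?_, rfl, ?_⟩
  -- Flipping signs on the `T` coordinates turns `diag - B` into `diag + B`.
  · convert hD.scale (Sum.elim (fun _ => 1) fun _ => -1) using 1
    ext (i | i) (j | j) <;> simp [diagonal_apply]
  · rw [Finset.sum_comm]
    exact Finset.sum_congr rfl fun s _ => Finset.sum_congr rfl fun t _ => by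
      rw [hΓ.real_symm]

end PosSemidef

end Matrix

/-! ### Signs of bits and sums of products. -/

open Matrix

/-- The sign `(-1) ^ b` of a bit. -/
def boolSign (b : Bool) : ℝ := if b then -1 else 1

@[simp] lemma boolSign_true : boolSign true = -1 := rfl

@[simp] lemma boolSign_false : boolSign false = 1 := rfl

lemma boolSign_sq (b : Bool) : boolSign b ^ 2 = 1 := by cases b <;> simp

lemma abs_boolSign (b : Bool) : |boolSign b| = 1 := by cases b <;> simp

lemma boolSign_indicator (a b f : Bool) :
    (if xor a b = f then (1 : ℝ) else 0) = (1 + boolSign a * boolSign b * boolSign f) / 2 := by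
  cases a <;> cases b <;> cases f <;> norm_num

lemma Fintype.sum_sum_prod {ι R : Type*} [Fintype ι] [DecidableEq ι] [CommSemiring R]
    {α β : ι → Type*} [∀ i, Fintype (α i)] [∀ i, Fintype (β i)] (F : ∀ i, α i → β i → R) :
    ∑ a : ∀ i, α i, ∑ b : ∀ i, β i, ∏ i, F i (a i) (b i) = ∏ i, ∑ x, ∑ y, F i x y := by
  rw [Fintype.prod_sum fun i x => ∑ y, F i x y]
  exact Finset.sum_congr rfl fun a _ => (Fintype.prod_sum fun i y => F i (a i) y).symm

/-! ### From single games to the conjunction. -/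

namespace XORGame

section Single

variable {S T : Type*} [Fintype S] [Fintype T]

/-- The matrix with entries `π(s,t) (-1)^f(s,t)`. -/
def signedMatrix (G : XORGame S T) : Matrix S T ℝ :=
  of fun s t => G.π s t * boolSign (G.f s t)

/-- The distribution of the questions, bordered by its marginals, is positive semidefinite. -/
lemma posSemidef_marginals [DecidableEq S] [DecidableEq T] (G : XORGame S T) :
    (fromBlocks (diagonal fun s => ∑ t, G.π s t) (of G.π) (of G.π)ᵀ
      (diagonal fun t => ∑ s, G.π s t)).PosSemidef := by
  refine posSemidef_real_iff.2 ⟨?_, fun x => ?_⟩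
  · rintro (i | i) (j | j)
    · rcases eq_or_ne i j with rfl | h
      · rfl
      · simp [h, h.symm]
    · simp
    · simp
    · rcases eq_or_ne i j with rfl | h
      · rfl
      · simp [h, h.symm]
  -- The quadratic form is the π-average of `(x s + x t)²`.
  · have h : 0 ≤ ∑ s, ∑ t, G.π s t * (x (.inl s) + x (.inr t)) ^ 2 :=
      Finset.sum_nonneg fun s _ => Finset.sum_nonneg fun t _ =>
        mul_nonneg (G.π_nonneg s t) (sq_nonneg _)
    convert h using 1
    simp only [Fintype.sum_sum_type, fromBlocks_apply₁₁, fromBlocks_apply₁₂, fromBlocks_apply₂₁,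
      fromBlocks_apply₂₂, diagonal_apply, mul_ite, ite_mul, mul_zero, zero_mul, Finset.sum_ite_eq,
      Finset.mem_univ, if_true, of_apply, transpose_apply, Finset.sum_add_distrib,
      Finset.mul_sum, Finset.sum_mul]
    rw [Finset.sum_comm (f := fun t s => x (Sum.inr t) * G.π s t * x (Sum.inl s)),
      Finset.sum_comm (f := fun t s => x (Sum.inr t) * G.π s t * x (Sum.inr t))]
    simp only [← Finset.sum_add_distrib]
    exact Finset.sum_congr rfl fun s _ => Finset.sum_congr rfl fun t _ => by ring

/-- The matrix indexed by pairs of a question and a bit whose even part is `M` and whose odd part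
is `N`. -/
def bitLift (M N : Matrix (S ⊕ T) (S ⊕ T) ℝ) :
    Matrix ((S × Bool) ⊕ (T × Bool)) ((S × Bool) ⊕ (T × Bool)) ℝ :=
  of fun x y => M (x.map Prod.fst Prod.fst) (y.map Prod.fst Prod.fst) +
    boolSign (x.elim Prod.snd Prod.snd) * boolSign (y.elim Prod.snd Prod.snd) *
      N (x.map Prod.fst Prod.fst) (y.map Prod.fst Prod.fst)

lemma posSemidef_bitLift {M N : Matrix (S ⊕ T) (S ⊕ T) ℝ} (hM : M.PosSemidef)
    (hN : N.PosSemidef) : (bitLift M N).PosSemidef :=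
  (hM.submatrix _).add ((hN.submatrix (Sum.map Prod.fst Prod.fst)).scale
    fun x => boolSign (x.elim Prod.snd Prod.snd))

end Single

section Product

variable {n : ℕ} {S T : Fin n → Type*}

/-- The restriction of a question and an answer of the conjunction to one of the games. -/
def coord (i : Fin n) : ((∀ i, S i) × (Fin n → Bool)) ⊕ ((∀ i, T i) × (Fin n → Bool)) →
    (S i × Bool) ⊕ (T i × Bool) :=
  Sum.map (fun x => (x.1 i, x.2 i)) fun x => (x.1 i, x.2 i)

variable [∀ i, Fintype (S i)] [∀ i, Fintype (T i)]

/-- The entrywise product of matrices belonging to the single games. -/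
def coordProd (M : ∀ i, Matrix ((S i × Bool) ⊕ (T i × Bool)) ((S i × Bool) ⊕ (T i × Bool)) ℝ) :
    Matrix (((∀ i, S i) × (Fin n → Bool)) ⊕ ((∀ i, T i) × (Fin n → Bool)))
      (((∀ i, S i) × (Fin n → Bool)) ⊕ ((∀ i, T i) × (Fin n → Bool))) ℝ :=
  of fun x y => ∏ i, M i (coord i x) (coord i y)

lemma posSemidef_coordProd
    {M : ∀ i, Matrix ((S i × Bool) ⊕ (T i × Bool)) ((S i × Bool) ⊕ (T i × Bool)) ℝ}
    (hM : ∀ i, (M i).PosSemidef) : (coordProd M).PosSemidef :=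
  PosSemidef.prod_entries Finset.univ (M := fun i => (M i).submatrix (coord i) (coord i))
    fun i => (hM i).submatrix _

/-- The winning predicate factors over the games. Each factor has the shape of an entry of
`bitLift`, which lets `C` appear as a block of a `coordProd`. -/
lemma costMatrix_conjunction (G : ∀ i, XORGame (S i) (T i)) (s : ∀ i, S i) (t : ∀ i, T i)
    (a b : Fin n → Bool) :
    (conjunction G).costMatrix (s, a) (t, b) = ∏ i, (1 / 2 * ((G i).π (s i) (t i) +
      boolSign (a i) * boolSign (b i) * (G i).signedMatrix (s i) (t i))) := by
  have h : (if (∀ i, xor (a i) (b i) = (G i).f (s i) (t i)) then (1 : ℝ) else 0) =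
      ∏ i, if xor (a i) (b i) = (G i).f (s i) (t i) then (1 : ℝ) else 0 := by
    rw [Finset.prod_ite_zero]
    simp
  simp only [TwoProverGame.costMatrix, conjunction, of_apply, decide_eq_true_eq]
  rw [h, ← Finset.prod_mul_distrib]
  refine Finset.prod_congr rfl fun i _ => ?_
  rw [boolSign_indicator, signedMatrix, of_apply]
  ring

end Product

end XORGame

lemma TwoProverGame.objective_eq_sum {S T A B : Type*} [Fintype S] [Fintype T] [Fintype A]
    [Fintype B] (G : TwoProverGame S T A B)
    {P : Matrix ((S × A) ⊕ (T × B)) ((S × A) ⊕ (T × B)) ℝ} (hP : ∀ i j, P i j = P j i) :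
    G.objective P = ∑ i, ∑ j, G.costMatrix i j * P (.inl i) (.inr j) := by
  simp only [objective, symCostMatrix, trace, diag_apply, mul_apply, Fintype.sum_sum_type,
    Matrix.smul_apply, fromBlocks_apply₁₁, fromBlocks_apply₁₂, fromBlocks_apply₂₁,
    fromBlocks_apply₂₂, Matrix.zero_apply, mul_zero, zero_mul, Finset.sum_const_zero, zero_add,
    add_zero, transpose_apply, smul_eq_mul]
  rw [Finset.sum_comm (f := fun j i => 1 / 2 * G.costMatrix i j * P (.inl i) (.inr j))]
  simp only [← Finset.sum_add_distrib]
  exact Finset.sum_congr rfl fun i _ => Finset.sum_congr rfl fun j _ => by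
    rw [hP (.inr j)]; ring

lemma FeasibleSigma.feasibleSigmaBar {S T A B : Type*} [Fintype A] [Fintype B]
    {P : Matrix ((S × A) ⊕ (T × B)) ((S × A) ⊕ (T × B)) ℝ} (hP : FeasibleSigma P) :
    FeasibleSigmaBar P where
  posSemidef := hP.posSemidef
  nonneg_ST _ _ _ _ := hP.nonneg _ _
  sum_SS s s' := by simpa only [abs_of_nonneg (hP.nonneg _ _)] using (hP.sum_SS s s').le
  sum_TT t t' := by simpa only [abs_of_nonneg (hP.nonneg _ _)] using (hP.sum_TT t t').le

/-! ### The upper bound from products of dual solutions. -/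

namespace XORGame

variable {n : ℕ} {S T : Fin n → Type*} [∀ i, Fintype (S i)] [∀ i, Fintype (T i)]

/-- Expanding the product over subsets `I` gives the characters of `I` with nonnegative
coefficients. Replacing every character sum by its bound 1 collapses the expansion to `∏ (u + v)`.
-/
lemma sum_prod_character_le (u v : ∀ i, S i → ℝ) (hu : ∀ i s, 0 ≤ u i s) (hv : ∀ i s, 0 ≤ v i s)
    (Q : (∀ i, S i) → (Fin n → Bool) → (Fin n → Bool) → ℝ)
    (hQ : ∀ (s) (I : Finset (Fin n)), ∑ a, ∑ a',
      (∏ i ∈ I, boolSign (a i)) * (∏ i ∈ I, boolSign (a' i)) * Q s a a' ≤ 1) :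
    ∑ s, ∑ a, ∑ a', (∏ i, (u i (s i) + boolSign (a i) * boolSign (a' i) * v i (s i))) * Q s a a' ≤
      ∏ i, ∑ s, (u i s + v i s) := by
  rw [Fintype.prod_sum]
  refine Finset.sum_le_sum fun s _ => ?_
  have hexp : ∀ a a' : Fin n → Bool,
      (∏ i, (u i (s i) + boolSign (a i) * boolSign (a' i) * v i (s i))) * Q s a a' =
      ∑ I : Finset (Fin n), ((∏ i ∈ I, v i (s i)) * ∏ i ∈ Iᶜ, u i (s i)) *
        ((∏ i ∈ I, boolSign (a i)) * (∏ i ∈ I, boolSign (a' i)) * Q s a a') := by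
    intro a a'
    simp only [add_comm (u _ _)]
    rw [Fintype.prod_add, Finset.sum_mul]
    refine Finset.sum_congr rfl fun I _ => ?_
    rw [Finset.prod_mul_distrib, Finset.prod_mul_distrib]
    ring
  simp only [hexp]
  simp only [add_comm (u _ _)]
  rw [Fintype.prod_add]
  calc _ = ∑ I : Finset (Fin n), ((∏ i ∈ I, v i (s i)) * ∏ i ∈ Iᶜ, u i (s i)) * ∑ a, ∑ a',
        ((∏ i ∈ I, boolSign (a i)) * (∏ i ∈ I, boolSign (a' i)) * Q s a a') := by
        simp only [Finset.mul_sum]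
        rw [Finset.sum_comm (s := (Finset.univ : Finset (Finset (Fin n))))]
        exact Finset.sum_congr rfl fun a _ => Finset.sum_comm
    _ ≤ _ := Finset.sum_le_sum fun I _ => mul_le_of_le_one_right
        (mul_nonneg (Finset.prod_nonneg fun i _ => hv i _) (Finset.prod_nonneg fun i _ => hu i _))
        (hQ s I)

/-- The bound on the objective function of the relaxations given by dual solutions for the
single games. -/
theorem objective_conjunction_le [∀ i, DecidableEq (S i)] [∀ i, DecidableEq (T i)]
    (G : ∀ i, XORGame (S i) (T i)) {p : ∀ i, S i → ℝ} {q : ∀ i, T i → ℝ} {γ : Fin n → ℝ}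
    (hD : ∀ i, (fromBlocks (diagonal (p i)) (G i).signedMatrix (G i).signedMatrixᵀ
      (diagonal (q i))).PosSemidef)
    (hp : ∀ i, ∑ s, p i s = γ i) (hq : ∀ i, ∑ t, q i t = γ i)
    {P : Matrix (((∀ i, S i) × (Fin n → Bool)) ⊕ ((∀ i, T i) × (Fin n → Bool)))
      (((∀ i, S i) × (Fin n → Bool)) ⊕ ((∀ i, T i) × (Fin n → Bool))) ℝ} (hP : P.PosSemidef)
    (hS : ∀ (s) (I : Finset (Fin n)), ∑ a, ∑ a', (∏ i ∈ I, boolSign (a i)) *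
      (∏ i ∈ I, boolSign (a' i)) * P (.inl (s, a)) (.inl (s, a')) ≤ 1)
    (hT : ∀ (t) (I : Finset (Fin n)), ∑ b, ∑ b', (∏ i ∈ I, boolSign (b i)) *
      (∏ i ∈ I, boolSign (b' i)) * P (.inr (t, b)) (.inr (t, b')) ≤ 1) :
    (conjunction G).objective P ≤ ∏ i, (1 + γ i) / 2 := by
  have hp0 : ∀ i s, 0 ≤ p i s := fun i s => by
    simpa using (hD i).diag_nonneg (i := Sum.inl s)
  have hq0 : ∀ i t, 0 ≤ q i t := fun i t => by
    simpa using (hD i).diag_nonneg (i := Sum.inr t)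
  -- The dual certificate for the conjunction: in each game the even part carries π with its
  -- marginals, the odd part the dual solution.
  set D := coordProd fun i => (1 / 2 : ℝ) • bitLift (fromBlocks (diagonal fun s => ∑ t, (G i).π s t)
    (of (G i).π) (of (G i).π)ᵀ (diagonal fun t => ∑ s, (G i).π s t)) (fromBlocks (diagonal (p i))
      (G i).signedMatrix (G i).signedMatrixᵀ (diagonal (q i))) with hDdef
  have hDpos : D.PosSemidef := posSemidef_coordProd fun i =>
    (posSemidef_bitLift (G i).posSemidef_marginals (hD i)).smul (by norm_num : (0 : ℝ) ≤ 1 / 2)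
  have hST : ∀ x y, D (.inl x) (.inr y) = (conjunction G).costMatrix x y := by
    rintro ⟨s, a⟩ ⟨t, b⟩
    rw [costMatrix_conjunction]
    simp [hDdef, coordProd, coord, bitLift]
  have hSS : ∀ s s' a a', D (.inl (s, a)) (.inl (s', a')) = if s = s' then
      ∏ i, (1 / 2 * (∑ t, (G i).π (s i) t) + boolSign (a i) * boolSign (a' i) *
        (1 / 2 * p i (s i))) else 0 := by
    intro s s' a a'
    split_ifs with h
    · subst h
      simp only [hDdef, coordProd, coord, bitLift, of_apply, Matrix.smul_apply, Sum.map_inl,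
        fromBlocks_apply₁₁, diagonal_apply_eq, Sum.elim_inl, smul_eq_mul]
      exact Finset.prod_congr rfl fun i _ => by ring
    -- Different questions differ in some game, and there both diagonal blocks vanish.
    · obtain ⟨i, hi⟩ := Function.ne_iff.1 h
      exact Finset.prod_eq_zero (Finset.mem_univ i) (by simp [coord, bitLift, hi])
  have hTT : ∀ t t' b b', D (.inr (t, b)) (.inr (t', b')) = if t = t' then
      ∏ i, (1 / 2 * (∑ s, (G i).π s (t i)) + boolSign (b i) * boolSign (b' i) *
        (1 / 2 * q i (t i))) else 0 := by
    intro t t' b b'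
    split_ifs with h
    · subst h
      simp only [hDdef, coordProd, coord, bitLift, of_apply, Matrix.smul_apply, Sum.map_inr,
        fromBlocks_apply₂₂, diagonal_apply_eq, Sum.elim_inr, smul_eq_mul]
      exact Finset.prod_congr rfl fun i _ => by ring
    · obtain ⟨i, hi⟩ := Function.ne_iff.1 h
      exact Finset.prod_eq_zero (Finset.mem_univ i) (by simp [coord, bitLift, hi])
  -- Negating the `T` coordinates of `P` makes the off-diagonal blocks contribute minus twice the
  -- objective.
  have hpair := hDpos.sum_mul_nonneg (hP.scale (Sum.elim (fun _ => 1) fun _ => -1))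
  have hobj := (conjunction G).objective_eq_sum hP.real_symm
  have hsplit : ∑ x, ∑ y, D x y *
      (of fun i j => Sum.elim (fun _ => 1) (fun _ => -1) i *
        Sum.elim (fun _ => 1) (fun _ => -1) j * P i j : Matrix _ _ ℝ) x y =
      (∑ x, ∑ y, D (.inl x) (.inl y) * P (.inl x) (.inl y)) +
      (∑ x, ∑ y, D (.inr x) (.inr y) * P (.inr x) (.inr y)) -
      2 * (conjunction G).objective P := by
    have hcomm : ∑ y, ∑ x, D (.inr y) (.inl x) * P (.inr y) (.inl x) =
        ∑ x, ∑ y, D (.inl x) (.inr y) * P (.inl x) (.inr y) := by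
      rw [Finset.sum_comm]
      exact Finset.sum_congr rfl fun x _ => Finset.sum_congr rfl fun y _ => by
        rw [hDpos.real_symm (.inr y), hP.real_symm (.inr y)]
    simp only [Fintype.sum_sum_type, of_apply, Sum.elim_inl, Sum.elim_inr, one_mul, mul_one,
      neg_mul, mul_neg, Finset.sum_add_distrib, Finset.sum_neg_distrib]
    rw [hcomm]
    simp only [hST]
    rw [hobj]
    ring
  have hL : ∑ x, ∑ y, D (.inl x) (.inl y) * P (.inl x) (.inl y) ≤ ∏ i, (1 + γ i) / 2 := by
    have h := sum_prod_character_le (fun i s => 1 / 2 * ∑ t, (G i).π s t)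
      (fun i s => 1 / 2 * p i s)
      (fun i s => mul_nonneg (by norm_num) (Finset.sum_nonneg fun t _ => (G i).π_nonneg s t))
      (fun i s => mul_nonneg (by norm_num) (hp0 i s)) _ hS
    convert h using 1
    · simp only [Fintype.sum_prod_type, hSS, ite_mul, zero_mul]
      refine Finset.sum_congr rfl fun s _ => Finset.sum_congr rfl fun a _ => ?_
      rw [Finset.sum_comm]
      simp
    · refine Finset.prod_congr rfl fun i _ => ?_
      rw [Finset.sum_add_distrib, ← Finset.mul_sum, ← Finset.mul_sum, hp, (G i).π_sum]
      ring
  have hR : ∑ x, ∑ y, D (.inr x) (.inr y) * P (.inr x) (.inr y) ≤ ∏ i, (1 + γ i) / 2 := by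
    have h := sum_prod_character_le (fun i t => 1 / 2 * ∑ s, (G i).π s t)
      (fun i t => 1 / 2 * q i t)
      (fun i t => mul_nonneg (by norm_num) (Finset.sum_nonneg fun s _ => (G i).π_nonneg s t))
      (fun i t => mul_nonneg (by norm_num) (hq0 i t)) _ hT
    convert h using 1
    · simp only [Fintype.sum_prod_type, hTT, ite_mul, zero_mul]
      refine Finset.sum_congr rfl fun s _ => Finset.sum_congr rfl fun a _ => ?_
      rw [Finset.sum_comm]
      simp
    · refine Finset.prod_congr rfl fun i _ => ?_
      rw [Finset.sum_add_distrib, ← Finset.mul_sum, ← Finset.mul_sum, hq, Finset.sum_comm,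
        (G i).π_sum]
      ring
  rw [hsplit] at hpair
  linarith

lemma sum_character_le_of_sum_abs_le {Q : (Fin n → Bool) → (Fin n → Bool) → ℝ}
    (hQ : ∑ a, ∑ a', |Q a a'| ≤ 1) (I : Finset (Fin n)) :
    ∑ a, ∑ a', (∏ i ∈ I, boolSign (a i)) * (∏ i ∈ I, boolSign (a' i)) * Q a a' ≤ 1 := by
  refine le_trans (Finset.sum_le_sum fun a _ => Finset.sum_le_sum fun a' _ => ?_) hQ
  refine (le_abs_self _).trans (le_of_eq ?_)
  simp [abs_mul, Finset.abs_prod, abs_boolSign]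

/-! ### The feasible matrix built from correlation matrices. -/

/-- The feasible solution given by correlation matrices for the single games. -/
noncomputable def correlationSolution
    (Γ : ∀ i, Matrix (S i ⊕ T i) (S i ⊕ T i) ℝ) :
    Matrix (((∀ i, S i) × (Fin n → Bool)) ⊕ ((∀ i, T i) × (Fin n → Bool)))
      (((∀ i, S i) × (Fin n → Bool)) ⊕ ((∀ i, T i) × (Fin n → Bool))) ℝ :=
  coordProd fun i => (1 / 4 : ℝ) • bitLift (of fun _ _ => 1) (Γ i)

/-- In each game the signed terms cancel over the four bit pairs, leaving `4 * (1 / 4)`. -/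
lemma sum_quarter_add_sign_mul (r : Fin n → ℝ) :
    ∑ a : Fin n → Bool, ∑ b : Fin n → Bool,
      ∏ i, ((1 / 4 : ℝ) * (1 + boolSign (a i) * boolSign (b i) * r i)) = 1 := by
  rw [Fintype.sum_sum_prod (β := fun _ => Bool)
    fun i a b => (1 / 4 : ℝ) * (1 + boolSign a * boolSign b * r i)]
  refine Finset.prod_eq_one fun i _ => ?_
  simp
  ring

lemma feasibleSigma_correlationSolution {Γ : ∀ i, Matrix (S i ⊕ T i) (S i ⊕ T i) ℝ}
    (hΓ : ∀ i, (Γ i).PosSemidef) (h1 : ∀ i x, Γ i x x = 1) :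
    FeasibleSigma (correlationSolution Γ) where
  posSemidef := posSemidef_coordProd fun i =>
    (posSemidef_bitLift (posSemidef_one_entries ℝ) (hΓ i)).smul (by norm_num : (0 : ℝ) ≤ 1 / 4)
  nonneg x y := by
    rw [correlationSolution, coordProd, of_apply]
    refine Finset.prod_nonneg fun i _ => ?_
    have h : |boolSign ((coord i x).elim Prod.snd Prod.snd) *
        boolSign ((coord i y).elim Prod.snd Prod.snd) * Γ i ((coord i x).map Prod.fst Prod.fst)
          ((coord i y).map Prod.fst Prod.fst)| ≤ 1 := by
      rw [abs_mul, abs_mul, abs_boolSign, abs_boolSign, one_mul, one_mul]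
      exact (hΓ i).abs_le_one (h1 i) _ _
    simp only [Matrix.smul_apply, bitLift, of_apply, smul_eq_mul]
    linarith [(abs_le.1 h).1]
  sum_SS s s' := sum_quarter_add_sign_mul fun i => Γ i (.inl (s i)) (.inl (s' i))
  sum_ST s t := sum_quarter_add_sign_mul fun i => Γ i (.inl (s i)) (.inr (t i))
  sum_TS t s := sum_quarter_add_sign_mul fun i => Γ i (.inr (t i)) (.inl (s i))
  sum_TT t t' := sum_quarter_add_sign_mul fun i => Γ i (.inr (t i)) (.inr (t' i))

/-- The success probability for answers with product distribution and unbiased marginals. -/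
lemma sum_costMatrix_mul_correlation (G : ∀ i, XORGame (S i) (T i)) (r : ∀ i, S i → T i → ℝ) :
    ∑ s, ∑ t, ∑ a, ∑ b, (conjunction G).costMatrix (s, a) (t, b) *
      ∏ i, ((1 / 4 : ℝ) * (1 + boolSign (a i) * boolSign (b i) * r i (s i) (t i))) =
      ∏ i, (1 + ∑ s, ∑ t, (G i).signedMatrix s t * r i s t) / 2 := by
  have hinner : ∀ s t, ∑ a, ∑ b, (conjunction G).costMatrix (s, a) (t, b) *
      ∏ i, ((1 / 4 : ℝ) * (1 + boolSign (a i) * boolSign (b i) * r i (s i) (t i))) =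
      ∏ i, (((G i).π (s i) (t i) + (G i).signedMatrix (s i) (t i) * r i (s i) (t i)) / 2) := by
    intro s t
    simp only [costMatrix_conjunction, ← Finset.prod_mul_distrib]
    rw [Fintype.sum_sum_prod (β := fun _ => Bool) fun i a b => 1 / 2 * ((G i).π (s i) (t i) +
      boolSign a * boolSign b * (G i).signedMatrix (s i) (t i)) *
        ((1 / 4 : ℝ) * (1 + boolSign a * boolSign b * r i (s i) (t i)))]
    -- Over the four bit pairs the terms with a single sign product cancel, while the product of the
    -- two signed terms has sign 1 and survives.
    refine Finset.prod_congr rfl fun i _ => ?_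
    simp
    ring
  simp only [hinner]
  rw [Fintype.sum_sum_prod fun i s t => ((G i).π s t + (G i).signedMatrix s t * r i s t) / 2]
  refine Finset.prod_congr rfl fun i _ => ?_
  simp only [← Finset.sum_div, Finset.sum_add_distrib, (G i).π_sum]

lemma objective_correlationSolution (G : ∀ i, XORGame (S i) (T i))
    {Γ : ∀ i, Matrix (S i ⊕ T i) (S i ⊕ T i) ℝ} (hΓ : ∀ i, (Γ i).PosSemidef)
    (h1 : ∀ i x, Γ i x x = 1) :
    (conjunction G).objective (correlationSolution Γ) =
      ∏ i, (1 + ∑ s, ∑ t, (G i).signedMatrix s t * Γ i (.inl s) (.inr t)) / 2 := by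
  rw [TwoProverGame.objective_eq_sum _
    (feasibleSigma_correlationSolution hΓ h1).posSemidef.real_symm,
    ← sum_costMatrix_mul_correlation G fun i s t => Γ i (.inl s) (.inr t)]
  simp only [Fintype.sum_prod_type]
  refine Finset.sum_congr rfl fun s _ => ?_
  rw [Finset.sum_comm]
  rfl

end XORGame

/-! ### Gram matrices of quantum strategies. -/

section QuantumUpperBound

/-- The real parts of the inner products of complex vectors form a positive semidefinite matrix. -/
lemma posSemidef_re_gram {ι κ : Type*} [Fintype ι] [Fintype κ] (w : ι → κ → ℂ) :
    (of fun x y => (star (w x) ⬝ᵥ w y).re : Matrix ι ι ℝ).PosSemidef := by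
  convert (posSemidef_conjTranspose_mul_self (of fun k x => (w x k).re)).add
    (posSemidef_conjTranspose_mul_self (of fun k x => (w x k).im)) using 1
  ext x y
  simp [mul_apply, dotProduct, ← Finset.sum_add_distrib]

/-- A combination of the elements of a POVM with coefficients `±1` is a contraction. -/
lemma sum_sign_povm_le {κ A : Type*} [Fintype κ] [DecidableEq κ] [Fintype A]
    {E : A → Matrix κ κ ℂ} (hE : ∀ a, (E a).PosSemidef) (hsum : ∑ a, E a = 1) {c : A → ℝ}
    (hc : ∀ a, c a ^ 2 = 1) (ψ : κ → ℂ) :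
    ∑ a, ∑ a', c a * c a' * (star (E a *ᵥ ψ) ⬝ᵥ (E a' *ᵥ ψ)).re ≤ (star ψ ⬝ᵥ ψ).re := by
  set H : Matrix κ κ ℂ := ∑ a, (c a : ℂ) • E a with hHdef
  have hH : Hᴴ = H := by
    simp [hHdef, conjTranspose_sum, (hE _).isHermitian.eq]
  -- This writes `1 - H²` as a sum of conjugates of the `E a`, using `c a ^ 2 = 1`; hence `H² ≤ 1`
  -- without dilating the POVM to a projective measurement.
  have hkey : ∑ a, ((c a : ℂ) • 1 - H)ᴴ * E a * ((c a : ℂ) • 1 - H) = 1 - H * H := by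
    have h : ∀ a, ((c a : ℂ) • 1 - H)ᴴ * E a * ((c a : ℂ) • 1 - H) =
        E a - ((c a : ℂ) • E a) * H - H * ((c a : ℂ) • E a) + H * E a * H := by
      intro a
      have hc' : (c a : ℂ) * c a = 1 := by
        rw [← Complex.ofReal_mul, ← pow_two, hc, Complex.ofReal_one]
      simp only [conjTranspose_sub, conjTranspose_smul, conjTranspose_one, hH, sub_mul, mul_sub,
        smul_mul_assoc, mul_smul_comm, one_mul, mul_one, smul_smul, Complex.star_def,
        Complex.conj_ofReal, hc', one_smul, smul_sub]
      abel
    simp only [h, Finset.sum_add_distrib, Finset.sum_sub_distrib, ← Finset.sum_mul,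
      ← Finset.mul_sum, hsum, ← hHdef, mul_one]
    abel
  have hpos : (1 - H * H).PosSemidef := by
    rw [← hkey]
    exact posSemidef_sum _ fun a _ => (hE a).conjTranspose_mul_mul_same _
  have h0 := (Complex.le_def.1 (hpos.dotProduct_mulVec_nonneg ψ)).1
  have hHH : star ψ ⬝ᵥ ((H * H) *ᵥ ψ) = star (H *ᵥ ψ) ⬝ᵥ (H *ᵥ ψ) := by
    rw [star_mulVec, hH, ← dotProduct_mulVec, mulVec_mulVec]
  have hexp : star (H *ᵥ ψ) ⬝ᵥ (H *ᵥ ψ) =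
      ∑ a, ∑ a', (c a * c a' : ℂ) * (star (E a *ᵥ ψ) ⬝ᵥ (E a' *ᵥ ψ)) := by
    simp only [hHdef, sum_mulVec, smul_mulVec, star_sum, star_smul, sum_dotProduct,
      dotProduct_sum, smul_dotProduct, dotProduct_smul, smul_eq_mul, Complex.star_def,
      Complex.conj_ofReal, Finset.mul_sum]
    rw [Finset.sum_comm]
    exact Finset.sum_congr rfl fun a _ => Finset.sum_congr rfl fun a' _ => by ring
  have hre : (star (H *ᵥ ψ) ⬝ᵥ (H *ᵥ ψ)).re =
      ∑ a, ∑ a', c a * c a' * (star (E a *ᵥ ψ) ⬝ᵥ (E a' *ᵥ ψ)).re := by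
    rw [hexp]
    simp only [Complex.re_sum, ← Complex.ofReal_mul, Complex.re_ofReal_mul]
  rw [sub_mulVec, dotProduct_sub, one_mulVec, hHH, Complex.sub_re, hre] at h0
  simpa using h0

lemma Matrix.sum_kronecker {A κ κ' : Type*} [Fintype A] (M : A → Matrix κ κ ℂ)
    (N : Matrix κ' κ' ℂ) : (∑ a, M a) ⊗ₖ N = ∑ a, M a ⊗ₖ N := by
  ext; simp [Matrix.sum_apply, Finset.sum_mul]

lemma Matrix.kronecker_sum {A κ κ' : Type*} [Fintype A] (M : Matrix κ κ ℂ)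
    (N : A → Matrix κ' κ' ℂ) : M ⊗ₖ (∑ a, N a) = ∑ a, M ⊗ₖ N a := by
  ext; simp [Matrix.sum_apply, Finset.mul_sum]

namespace QuantumStrategy

variable {S T A B : Type*} [Fintype A] [Fintype B]

/-- The measurement operators of both provers, on the joint system. -/
noncomputable def jointOperator (Q : QuantumStrategy S T A B) :
    (S × A) ⊕ (T × B) → Matrix (Fin Q.dA × Fin Q.dB) (Fin Q.dA × Fin Q.dB) ℂ :=
  Sum.elim (fun x => Q.M x.1 x.2 ⊗ₖ 1) fun y => 1 ⊗ₖ Q.N y.1 y.2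

/-- The real parts of the inner products of the vectors obtained by applying the measurement
operators to the shared state. -/
noncomputable def gramMatrix (Q : QuantumStrategy S T A B) :
    Matrix ((S × A) ⊕ (T × B)) ((S × A) ⊕ (T × B)) ℝ :=
  of fun x y => (star (Q.jointOperator x *ᵥ Q.ψ) ⬝ᵥ (Q.jointOperator y *ᵥ Q.ψ)).re

lemma posSemidef_gramMatrix [Fintype S] [Fintype T] (Q : QuantumStrategy S T A B) :
    Q.gramMatrix.PosSemidef :=
  posSemidef_re_gram fun x => Q.jointOperator x *ᵥ Q.ψ

lemma gramMatrix_inl_inr (Q : QuantumStrategy S T A B) (s : S) (t : T) (a : A) (b : B) :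
    Q.gramMatrix (.inl (s, a)) (.inr (t, b)) = Q.prob s t a b := by
  simp only [gramMatrix, prob, jointOperator, of_apply, Sum.elim_inl, Sum.elim_inr]
  rw [star_mulVec, ← dotProduct_mulVec, mulVec_mulVec, conjTranspose_kronecker,
    (Q.M_pos s a).isHermitian.eq, conjTranspose_one, ← mul_kronecker_mul, one_mul, mul_one]

lemma sum_sign_gramMatrix_inl_le (Q : QuantumStrategy S T A B) (s : S) {c : A → ℝ}
    (hc : ∀ a, c a ^ 2 = 1) :
    ∑ a, ∑ a', c a * c a' * Q.gramMatrix (.inl (s, a)) (.inl (s, a')) ≤ 1 := by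
  have h := sum_sign_povm_le (E := fun a => Q.M s a ⊗ₖ (1 : Matrix (Fin Q.dB) (Fin Q.dB) ℂ))
    (fun a => (Q.M_pos s a).kronecker PosSemidef.one)
    (by rw [← Matrix.sum_kronecker, Q.M_sum, one_kronecker_one]) hc Q.ψ
  rwa [Q.ψ_unit, Complex.one_re] at h

lemma sum_sign_gramMatrix_inr_le (Q : QuantumStrategy S T A B) (t : T) {c : B → ℝ}
    (hc : ∀ b, c b ^ 2 = 1) :
    ∑ b, ∑ b', c b * c b' * Q.gramMatrix (.inr (t, b)) (.inr (t, b')) ≤ 1 := by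
  have h := sum_sign_povm_le (E := fun b => (1 : Matrix (Fin Q.dA) (Fin Q.dA) ℂ) ⊗ₖ Q.N t b)
    (fun b => PosSemidef.one.kronecker (Q.N_pos t b))
    (by rw [← Matrix.kronecker_sum, Q.N_sum, one_kronecker_one]) hc Q.ψ
  rwa [Q.ψ_unit, Complex.one_re] at h

end QuantumStrategy

lemma TwoProverGame.successProb_eq_sum {S T A B : Type*} [Fintype S] [Fintype T] [Fintype A]
    [Fintype B] (G : TwoProverGame S T A B) (Q : QuantumStrategy S T A B) :
    G.successProb Q =
      ∑ s, ∑ t, ∑ a, ∑ b, G.costMatrix (s, a) (t, b) * Q.prob s t a b := by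
  simp only [successProb, costMatrix, of_apply, Finset.mul_sum, mul_ite, mul_one, mul_zero,
    ite_mul, zero_mul]

/-- The objective sees only the off-diagonal blocks, where the Gram entries are the answer
probabilities. -/
lemma TwoProverGame.successProb_eq_objective {S T A B : Type*} [Fintype S] [Fintype T]
    [Fintype A] [Fintype B] (G : TwoProverGame S T A B) (Q : QuantumStrategy S T A B) :
    G.successProb Q = G.objective Q.gramMatrix := by
  rw [G.objective_eq_sum Q.posSemidef_gramMatrix.real_symm,
    G.successProb_eq_sum]
  simp only [Fintype.sum_prod_type]
  refine Finset.sum_congr rfl fun s _ => ?_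
  rw [Finset.sum_comm]
  simp only [Q.gramMatrix_inl_inr]

end QuantumUpperBound

/-! ### Clifford generators and Tsirelson's observables. -/

section Clifford

/-- There are arbitrarily many pairwise anticommuting traceless Hermitian involutions. -/
lemma exists_clifford_generators (k : ℕ) :
    ∃ (κ : Type) (_ : Fintype κ) (_ : DecidableEq κ) (_ : Nonempty κ)
      (C : Fin k → Matrix κ κ ℂ), (∀ j, (C j)ᴴ = C j) ∧ (∀ j, (C j).trace = 0) ∧
      ∀ j l, C j * C l + C l * C j = (if j = l then 2 else 0 : ℂ) • (1 : Matrix κ κ ℂ) := by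
  induction k with
  | zero => exact ⟨Unit, inferInstance, inferInstance, inferInstance, Fin.elim0,
      fun j => j.elim0, fun j => j.elim0, fun j => j.elim0⟩
  | succ k ih =>
    obtain ⟨κ, _, _, _, C, hC, htr, hanti⟩ := ih
    set X : Matrix (Fin 2) (Fin 2) ℂ := !![0, 1; 1, 0]
    set Z : Matrix (Fin 2) (Fin 2) ℂ := !![1, 0; 0, -1]
    have hX : Xᴴ = X := by ext i j; fin_cases i <;> fin_cases j <;> simp [X]
    have hZ : Zᴴ = Z := by ext i j; fin_cases i <;> fin_cases j <;> simp [Z]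
    have hXX : X * X = 1 := by simp [X, one_fin_two]
    have hZZ : Z * Z = 1 := by simp [Z, one_fin_two]
    have hXZ : X * Z + Z * X = 0 := by
      ext i j; fin_cases i <;> fin_cases j <;> simp [X, Z]
    have hmix : ∀ j, (C j ⊗ₖ X) * ((1 : Matrix κ κ ℂ) ⊗ₖ Z) + (1 ⊗ₖ Z) * (C j ⊗ₖ X) = 0 := by
      intro j
      rw [← mul_kronecker_mul, ← mul_kronecker_mul, one_mul, mul_one, ← kronecker_add, hXZ,
        kronecker_zero]
    -- Tensoring old generators with `X` keeps their relations since `X² = 1`; the new generator `1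
    -- ⊗ Z` anticommutes with them because `X` and `Z` do.
    refine ⟨κ × Fin 2, inferInstance, inferInstance, inferInstance,
      Fin.cons (1 ⊗ₖ Z) fun j => C j ⊗ₖ X, ?_, ?_, ?_⟩
    · refine Fin.cases ?_ fun j => ?_
      · simp [conjTranspose_kronecker, hZ]
      · simp [conjTranspose_kronecker, hX, hC]
    · refine Fin.cases ?_ fun j => ?_
      · simp [trace_kronecker, Z, trace_fin_two]
      · simp [trace_kronecker, htr]
    · refine Fin.cases (Fin.cases ?_ fun l => ?_) fun j => Fin.cases ?_ fun l => ?_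
      · simp only [Fin.cons_zero, ← mul_kronecker_mul, one_mul, hZZ, one_kronecker_one, if_true]
        rw [two_smul]
      · simp only [Fin.cons_zero, Fin.cons_succ, (Fin.succ_ne_zero l).symm, if_false, zero_smul]
        rw [add_comm, hmix]
      · simp only [Fin.cons_zero, Fin.cons_succ, Fin.succ_ne_zero j, if_false, zero_smul]
        rw [hmix]
      · simp only [Fin.cons_succ, ← mul_kronecker_mul, hXX, ← add_kronecker, hanti,
          Fin.succ_inj, smul_kronecker, one_kronecker_one]

open scoped MatrixOrder in
/-- A real positive semidefinite matrix is the Gram matrix of real vectors. -/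
lemma Matrix.PosSemidef.exists_gram {ι : Type*} [Fintype ι] {Γ : Matrix ι ι ℝ}
    (hΓ : Γ.PosSemidef) : ∃ u : ι → ι → ℝ, ∀ i j, Γ i j = ∑ k, u i k * u j k := by
  classical
  obtain ⟨a, ha⟩ := CStarAlgebra.nonneg_iff_eq_star_mul_self.mp hΓ.nonneg
  refine ⟨fun i k => a k i, fun i j => ?_⟩
  rw [ha]
  simp [star_eq_conjTranspose, mul_apply]

/-- Tsirelson's construction: a correlation matrix is realized by traceless Hermitian
involutions. -/
lemma exists_observables {ι : Type*} [Fintype ι] {Γ : Matrix ι ι ℝ} (hΓ : Γ.PosSemidef)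
    (h1 : ∀ i, Γ i i = 1) :
    ∃ (κ : Type) (_ : Fintype κ) (_ : DecidableEq κ) (_ : Nonempty κ)
      (X : ι → Matrix κ κ ℂ), (∀ i, (X i)ᴴ = X i) ∧ (∀ i, (X i).trace = 0) ∧
      (∀ i, X i * X i = 1) ∧ ∀ i j, (X i * X j).trace = Fintype.card κ * Γ i j := by
  obtain ⟨u, hu⟩ := hΓ.exists_gram
  obtain ⟨κ, _, _, _, C, hC, htr, hanti⟩ := exists_clifford_generators (Fintype.card ι)
  set e := Fintype.equivFin ι
  set X : ι → Matrix κ κ ℂ := fun i => ∑ k, (u i k : ℂ) • C (e k) with hX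
  -- The Clifford relations turn the anticommutator into the inner product of the Gram vectors; the
  -- diagonal case gives involutions, the trace gives the correlations.
  have hXX : ∀ i j, X i * X j + X j * X i = (2 * Γ i j : ℂ) • (1 : Matrix κ κ ℂ) := by
    intro i j
    have h2 : X j * X i = ∑ k, ∑ l, (u i k * u j l : ℂ) • (C (e l) * C (e k)) := by
      simp only [hX, Finset.sum_mul, Finset.mul_sum, smul_mul_assoc, mul_smul_comm,
        Finset.smul_sum, smul_smul]
    have h3 : X i * X j = ∑ k, ∑ l, (u i k * u j l : ℂ) • (C (e k) * C (e l)) := by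
      simp only [hX, Finset.sum_mul, Finset.mul_sum, smul_mul_assoc, mul_smul_comm,
        Finset.smul_sum, smul_smul]
      rw [Finset.sum_comm]
      exact Finset.sum_congr rfl fun k _ => Finset.sum_congr rfl fun l _ => by rw [mul_comm]
    classical
    simp only [h2, h3, ← Finset.sum_add_distrib, ← smul_add, hanti, e.injective.eq_iff, smul_ite,
      smul_smul, smul_zero, ite_smul, zero_smul, Finset.sum_ite_eq, Finset.mem_univ, if_true]
    rw [hu, ← Finset.sum_smul, Complex.ofReal_sum, Finset.mul_sum]
    congr 1
    refine Finset.sum_congr rfl fun k _ => ?_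
    push_cast
    ring
  refine ⟨κ, ‹_›, ‹_›, ‹_›, X, fun i => ?_, fun i => ?_, fun i => ?_, fun i j => ?_⟩
  · simp [hX, conjTranspose_sum, hC]
  · simp [hX, trace_sum, htr]
  · have h := hXX i i
    rw [h1, ← two_smul ℂ (X i * X i)] at h
    simpa using h
  · have h := congrArg trace (hXX i j)
    rw [trace_add, trace_mul_comm (X j), trace_smul, trace_one, smul_eq_mul] at h
    linear_combination h / 2

end Clifford

/-! ### Sign measurements on the maximally entangled state. -/

section Tsirelson

/-- The projection onto the eigenspace of an involution given by a bit. -/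
noncomputable def signProjection {κ : Type*} [DecidableEq κ] (X : Matrix κ κ ℂ) (a : Bool) :
    Matrix κ κ ℂ :=
  (1 / 2 : ℂ) • (1 + (boolSign a : ℂ) • X)

lemma posSemidef_signProjection {κ : Type*} [Fintype κ] [DecidableEq κ] {X : Matrix κ κ ℂ}
    (hX : Xᴴ = X) (hXX : X * X = 1) (a : Bool) : (signProjection X a).PosSemidef := by
  have hH : (signProjection X a)ᴴ = signProjection X a := by
    simp [signProjection, hX]
  have h : signProjection X a = (signProjection X a)ᴴ * signProjection X a := by
    rw [hH]
    simp only [signProjection, add_mul, mul_add, one_mul, mul_one, smul_mul_assoc, mul_smul_comm,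
      smul_smul, hXX, smul_add]
    cases a <;> simp only [boolSign_true, boolSign_false] <;> push_cast <;> module
  rw [h]
  exact posSemidef_conjTranspose_mul_self _

lemma sum_signProjection {κ : Type*} [DecidableEq κ] (X : Matrix κ κ ℂ) :
    ∑ a, signProjection X a = 1 := by
  simp only [signProjection, Fintype.sum_bool, boolSign_true, boolSign_false]
  push_cast
  module

/-- The maximally entangled state. -/
noncomputable def maxEntangled (κ : Type*) [Fintype κ] [DecidableEq κ] : κ × κ → ℂ :=
  fun x => if x.1 = x.2 then ((√(Fintype.card κ : ℝ))⁻¹ : ℝ) else 0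

/-- The state identifies the two indices of each pair, so the expectation contracts to a trace. The
transpose on the second factor puts the product in the order `M * N`. -/
lemma maxEntangled_kronecker_transpose {κ : Type*} [Fintype κ] [DecidableEq κ]
    (M N : Matrix κ κ ℂ) :
    star (maxEntangled κ) ⬝ᵥ ((M ⊗ₖ Nᵀ) *ᵥ maxEntangled κ) =
      (Fintype.card κ : ℂ)⁻¹ * (M * N).trace := by
  have hs : (((√(Fintype.card κ : ℝ))⁻¹ : ℝ) : ℂ) * ((√(Fintype.card κ : ℝ))⁻¹ : ℝ) =
      (Fintype.card κ : ℂ)⁻¹ := by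
    rw [← Complex.ofReal_mul, ← mul_inv, Real.mul_self_sqrt (Nat.cast_nonneg _)]
    simp
  simp only [dotProduct, mulVec, Pi.star_apply, Fintype.sum_prod_type, maxEntangled,
    kroneckerMap_apply, transpose_apply, apply_ite star, star_zero, Complex.star_def,
    Complex.conj_ofReal, ite_mul, zero_mul, mul_ite, mul_zero, Finset.sum_ite_eq, Finset.mem_univ,
    if_true, trace, diag_apply, mul_apply]
  simp only [Finset.mul_sum]
  refine Finset.sum_congr rfl fun x _ => Finset.sum_congr rfl fun y _ => ?_
  rw [← hs]
  ring

lemma maxEntangled_unit (κ : Type*) [Fintype κ] [DecidableEq κ] [Nonempty κ] :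
    star (maxEntangled κ) ⬝ᵥ maxEntangled κ = 1 := by
  have h := maxEntangled_kronecker_transpose (1 : Matrix κ κ ℂ) 1
  rw [transpose_one, one_kronecker_one, one_mulVec, mul_one, trace_one] at h
  rw [h, inv_mul_cancel₀ (Nat.cast_ne_zero.2 Fintype.card_ne_zero)]

/-- Measuring traceless observables on the maximally entangled state. -/
lemma maxEntangled_signProjection {κ : Type*} [Fintype κ] [DecidableEq κ] [Nonempty κ]
    {X Y : Matrix κ κ ℂ} {r : ℝ} (hX : X.trace = 0) (hY : Y.trace = 0)
    (hXY : (X * Y).trace = Fintype.card κ * r) (a b : Bool) :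
    star (maxEntangled κ) ⬝ᵥ
      ((signProjection X a ⊗ₖ (signProjection Y b)ᵀ) *ᵥ maxEntangled κ) =
      ((1 / 4 * (1 + boolSign a * boolSign b * r) : ℝ) : ℂ) := by
  have hc : (Fintype.card κ : ℂ) ≠ 0 := Nat.cast_ne_zero.2 Fintype.card_ne_zero
  rw [maxEntangled_kronecker_transpose]
  simp only [signProjection, smul_mul_assoc, mul_smul_comm, add_mul, mul_add, one_mul, mul_one,
    trace_smul, trace_add, trace_one, hX, hY, hXY, smul_eq_mul]
  push_cast
  field_simp
  ring

end Tsirelson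

/-- A quantum strategy may be given on spaces with arbitrary finite bases. -/
lemma QuantumStrategy.exists_of_fintype {S T A B K L : Type*} [Fintype A] [Fintype B] [Fintype K]
    [DecidableEq K] [Fintype L] [DecidableEq L] {ψ : K × L → ℂ} (hψ : star ψ ⬝ᵥ ψ = 1)
    {M : S → A → Matrix K K ℂ} (hM : ∀ s a, (M s a).PosSemidef) (hM1 : ∀ s, ∑ a, M s a = 1)
    {N : T → B → Matrix L L ℂ} (hN : ∀ t b, (N t b).PosSemidef) (hN1 : ∀ t, ∑ b, N t b = 1) :
    ∃ Q : QuantumStrategy S T A B, ∀ s t a b,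
      Q.prob s t a b = (star ψ ⬝ᵥ ((M s a ⊗ₖ N t b) *ᵥ ψ)).re := by
  set e := (Fintype.equivFin K).symm
  set f := (Fintype.equivFin L).symm
  refine ⟨{
    dA := Fintype.card K
    dB := Fintype.card L
    ψ := ψ ∘ e.prodCongr f
    ψ_unit := ?_
    M := fun s a => (M s a).submatrix e e
    M_pos := fun s a => (hM s a).submatrix e
    M_sum := fun s => ?_
    N := fun t b => (N t b).submatrix f f
    N_pos := fun t b => (hN t b).submatrix f
    N_sum := fun t => ?_ }, fun s t a b => ?_⟩
  · rw [← hψ]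
    exact comp_equiv_dotProduct_comp_equiv (star ψ) ψ (e.prodCongr f)
  · rw [← submatrix_one_equiv e, ← hM1 s]
    ext; simp [Matrix.sum_apply]
  · rw [← submatrix_one_equiv f, ← hN1 t]
    ext; simp [Matrix.sum_apply]
  · have hk : (M s a).submatrix e e ⊗ₖ (N t b).submatrix f f =
        (M s a ⊗ₖ N t b).submatrix (e.prodCongr f) (e.prodCongr f) := rfl
    simp only [QuantumStrategy.prob]
    rw [hk, submatrix_mulVec_equiv, Function.comp_assoc, Equiv.self_comp_symm, Function.comp_id]
    exact congrArg Complex.re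
      (comp_equiv_dotProduct_comp_equiv (star ψ) ((M s a ⊗ₖ N t b) *ᵥ ψ) (e.prodCongr f))

/-! ### Tensor products of states and measurements. -/

section TensorProduct

variable {n : ℕ} {K L : Fin n → Type*}

/-- The tensor product of states. -/
def tensorState (ψ : ∀ i, K i × L i → ℂ) : (∀ i, K i) × (∀ i, L i) → ℂ :=
  fun x => ∏ i, ψ i (x.1 i, x.2 i)

/-- The tensor product of matrices. -/
def tensorMatrix (M : ∀ i, Matrix (K i) (K i) ℂ) : Matrix (∀ i, K i) (∀ i, K i) ℂ :=
  of fun x y => ∏ i, M i (x i) (y i)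

lemma sum_tensorMatrix [∀ i, DecidableEq (K i)] {M : ∀ i, Bool → Matrix (K i) (K i) ℂ}
    (hM : ∀ i, ∑ a, M i a = 1) : ∑ a : Fin n → Bool, tensorMatrix (fun i => M i (a i)) = 1 := by
  ext x y
  simp only [Matrix.sum_apply, tensorMatrix, of_apply]
  rw [← Fintype.prod_sum fun i b => M i b (x i) (y i)]
  simp only [← Matrix.sum_apply, hM, one_apply]
  rw [Finset.prod_ite_zero]
  simp [funext_iff]

variable [∀ i, Fintype (K i)] [∀ i, Fintype (L i)]

lemma posSemidef_tensorMatrix {M : ∀ i, Matrix (K i) (K i) ℂ} (hM : ∀ i, (M i).PosSemidef) :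
    (tensorMatrix M).PosSemidef :=
  PosSemidef.prod_entries Finset.univ
    (M := fun i => (M i).submatrix (fun x : ∀ i, K i => x i) fun x => x i)
    fun i => (hM i).submatrix _

lemma tensorState_dotProduct (φ ψ : ∀ i, K i × L i → ℂ) :
    star (tensorState φ) ⬝ᵥ tensorState ψ = ∏ i, star (φ i) ⬝ᵥ ψ i := by
  simp only [dotProduct, Fintype.sum_prod_type, tensorState, Pi.star_apply, star_prod,
    ← Finset.prod_mul_distrib]
  exact Fintype.sum_sum_prod fun i x y => star (φ i (x, y)) * ψ i (x, y)

lemma tensorMatrix_kronecker_mulVec (M : ∀ i, Matrix (K i) (K i) ℂ)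
    (N : ∀ i, Matrix (L i) (L i) ℂ) (ψ : ∀ i, K i × L i → ℂ) :
    (tensorMatrix M ⊗ₖ tensorMatrix N) *ᵥ tensorState ψ =
      tensorState fun i => (M i ⊗ₖ N i) *ᵥ ψ i := by
  ext ⟨x, y⟩
  simp only [mulVec, dotProduct, Fintype.sum_prod_type, tensorState, tensorMatrix,
    kroneckerMap_apply, of_apply, ← Finset.prod_mul_distrib]
  exact Fintype.sum_sum_prod fun i x' y' => M i (x i) x' * N i (y i) y' * ψ i (x', y')

end TensorProduct

/-! ### Tsirelson strategies in parallel. -/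

namespace XORGame

variable {n : ℕ} {S T : Fin n → Type*}

/-- Measuring observables for the single games in parallel. -/
lemma exists_quantumStrategy_of_observables {κ : Fin n → Type*} [∀ i, Fintype (κ i)]
    [∀ i, DecidableEq (κ i)] [∀ i, Nonempty (κ i)] {Γ : ∀ i, Matrix (S i ⊕ T i) (S i ⊕ T i) ℝ}
    {X : ∀ i, S i ⊕ T i → Matrix (κ i) (κ i) ℂ} (hX : ∀ i x, (X i x)ᴴ = X i x)
    (htr : ∀ i x, (X i x).trace = 0) (hXX : ∀ i x, X i x * X i x = 1)
    (hXY : ∀ i x y, (X i x * X i y).trace = Fintype.card (κ i) * Γ i x y) :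
    ∃ Q : QuantumStrategy (∀ i, S i) (∀ i, T i) (Fin n → Bool) (Fin n → Bool), ∀ s t a b,
      Q.prob s t a b =
        ∏ i, (1 / 4 * (1 + boolSign (a i) * boolSign (b i) * Γ i (.inl (s i)) (.inr (t i)))) := by
  have hψ : star (tensorState fun i => maxEntangled (κ i)) ⬝ᵥ
      (tensorState fun i => maxEntangled (κ i)) = 1 := by
    rw [tensorState_dotProduct]
    exact Finset.prod_eq_one fun i _ => maxEntangled_unit _
  have hM (s : ∀ i, S i) : ∑ a : Fin n → Bool,
      tensorMatrix (fun i => signProjection (X i (.inl (s i))) (a i)) = 1 :=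
    sum_tensorMatrix (M := fun i => signProjection (X i (.inl (s i)))) fun i =>
      sum_signProjection _
  have hN (t : ∀ i, T i) : ∑ b : Fin n → Bool,
      tensorMatrix (fun i => (signProjection (X i (.inr (t i))) (b i))ᵀ) = 1 :=
    sum_tensorMatrix (M := fun i b => (signProjection (X i (.inr (t i))) b)ᵀ) fun i => by
      rw [← transpose_sum, sum_signProjection, transpose_one]
  obtain ⟨Q, hQ⟩ := QuantumStrategy.exists_of_fintype hψ
    (fun (s : ∀ i, S i) (a : Fin n → Bool) => posSemidef_tensorMatrix fun i =>
      posSemidef_signProjection (hX i (.inl (s i))) (hXX i (.inl (s i))) (a i)) hM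
    (fun (t : ∀ i, T i) (b : Fin n → Bool) => posSemidef_tensorMatrix fun i =>
      (posSemidef_signProjection (hX i (.inr (t i))) (hXX i (.inr (t i))) (b i)).transpose) hN
  refine ⟨Q, fun s t a b => ?_⟩
  rw [hQ, tensorMatrix_kronecker_mulVec, tensorState_dotProduct]
  rw [Finset.prod_congr rfl fun i _ => maxEntangled_signProjection (htr i (.inl (s i)))
    (htr i (.inr (t i))) (hXY i _ _) (a i) (b i), ← Complex.ofReal_prod, Complex.ofReal_re]

/-- Playing Tsirelson's strategies for the single games in parallel. -/
lemma exists_quantumStrategy [∀ i, Fintype (S i)] [∀ i, Fintype (T i)]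
    {Γ : ∀ i, Matrix (S i ⊕ T i) (S i ⊕ T i) ℝ}
    (hΓ : ∀ i, (Γ i).PosSemidef) (h1 : ∀ i x, Γ i x x = 1) :
    ∃ Q : QuantumStrategy (∀ i, S i) (∀ i, T i) (Fin n → Bool) (Fin n → Bool), ∀ s t a b,
      Q.prob s t a b =
        ∏ i, (1 / 4 * (1 + boolSign (a i) * boolSign (b i) * Γ i (.inl (s i)) (.inr (t i)))) := by
  choose κ hF hDec hN X hX htr hXX hXY using fun i => exists_observables (hΓ i) (h1 i)
  exact exists_quantumStrategy_of_observables hX htr hXX hXY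

end XORGame

/-- The first three conjuncts say that the suprema defining `ω_q`, `σ` and `σ̄` are maxima. -/
theorem mainTheorem4 {n : ℕ} {S T : Fin n → Type*} [∀ i, Fintype (S i)] [∀ i, Fintype (T i)]
    (G : ∀ i, XORGame (S i) (T i)) :
    IsGreatest (Set.range (XORGame.conjunction G).successProb)
        (XORGame.conjunction G).quantumValue ∧
      IsGreatest ((XORGame.conjunction G).objective '' {P | FeasibleSigma P})
        (XORGame.conjunction G).sigma ∧
      IsGreatest ((XORGame.conjunction G).objective '' {P | FeasibleSigmaBar P})
        (XORGame.conjunction G).sigmaBar ∧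
      (XORGame.conjunction G).quantumValue = (XORGame.conjunction G).sigma ∧
      (XORGame.conjunction G).sigma = (XORGame.conjunction G).sigmaBar := by
  classical
  -- One optimal primal-dual pair per game: Γ serves the lower bounds, `p` and `q` the upper bounds.
  choose Γ p q hΓ h1 hD hp hq using
    fun i => exists_bipartite_correlation_dual (G i).signedMatrix
  set W : ℝ := ∏ i, (1 + ∑ s, ∑ t, (G i).signedMatrix s t * Γ i (.inl s) (.inr t)) / 2 with hW
  have hquantum : IsGreatest (Set.range (XORGame.conjunction G).successProb) W := by
    constructor
    · obtain ⟨Q, hQ⟩ := XORGame.exists_quantumStrategy hΓ h1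
      refine ⟨Q, ?_⟩
      rw [TwoProverGame.successProb_eq_sum]
      simp only [hQ]
      exact XORGame.sum_costMatrix_mul_correlation G fun i s t => Γ i (.inl s) (.inr t)
    · rintro _ ⟨Q, rfl⟩
      -- Characters are `±1`-valued, so the POVM contraction bound supplies the character sums
      -- required of the Gram matrix.
      have hc : ∀ (I : Finset (Fin n)) (a : Fin n → Bool),
          (∏ i ∈ I, boolSign (a i)) ^ 2 = 1 := fun I a => by
        rw [← Finset.prod_pow]
        exact Finset.prod_eq_one fun i _ => boolSign_sq _
      rw [TwoProverGame.successProb_eq_objective]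
      exact XORGame.objective_conjunction_le G hD hp hq Q.posSemidef_gramMatrix
        (fun s I => Q.sum_sign_gramMatrix_inl_le s (hc I))
        (fun t I => Q.sum_sign_gramMatrix_inr_le t (hc I))
  have hfeas := XORGame.feasibleSigma_correlationSolution hΓ h1
  have hobj := XORGame.objective_correlationSolution G hΓ h1
  have hbar : IsGreatest ((XORGame.conjunction G).objective '' {P | FeasibleSigmaBar P}) W := by
    refine ⟨⟨_, hfeas.feasibleSigmaBar, hobj⟩, ?_⟩
    rintro _ ⟨P, hP, rfl⟩
    exact XORGame.objective_conjunction_le G hD hp hq hP.posSemidef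
      (fun s I => XORGame.sum_character_le_of_sum_abs_le (hP.sum_SS s s) I)
      (fun t I => XORGame.sum_character_le_of_sum_abs_le (hP.sum_TT t t) I)
  have hsigma : IsGreatest ((XORGame.conjunction G).objective '' {P | FeasibleSigma P}) W :=
    ⟨⟨_, hfeas, hobj⟩, fun _ ⟨P, hP, h⟩ => hbar.2 ⟨P, FeasibleSigma.feasibleSigmaBar hP, h⟩⟩
  have e1 : (XORGame.conjunction G).quantumValue = W := hquantum.csSup_eq
  have e2 : (XORGame.conjunction G).sigma = W := hsigma.csSup_eq
  have e3 : (XORGame.conjunction G).sigmaBar = W := hbar.csSup_eq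
  rw [e1, e2, e3]
  exact ⟨hquantum, hsigma, hbar, rfl, rfl⟩
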